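/- Let $2\le n\le\infty$ and let $\mathcal O_n$ be the Cuntz algebra, that is, the universal unital C$^*$-algebra generated by $s_1,\dots,s_n$ (by $s_1,s_2,\dots$ if $n=\infty$) subject to $s_i^*s_j=\delta_{ij}I$ for all $i,j$, together with $\sum_{i=1}^n s_is_i^*=I$ if $n<\infty$, and $\sum_{i=1}^k s_is_i^*\le I$ for all $k\ge1$ if $n=\infty$. A state is pure if it is an extreme point of the set of all states. For a state $\omega$ on $\mathcal O_n$ with GNS representation $(\mathcal H,\pi,\Omega)$ let $\mathcal K(\omega)\subset\mathcal H$ be the closed linear span of the vectors $\pi(s_{j_1}\cdots s_{j_l})^*\Omega$ for all $l\ge0$ and all indices $j_1,\dots,j_l$ (for $l=0$ this is $\Omega$), and put $\operatorname{cdim}\omega:=\dim\mathcal K(\omega)\in\{1,2,\dots,\infty\}$. Write $\omega'\sim\omega$ if the GNS representations of $\omega'$ and $\omega$ are unitarily equivalent, put $\kappa(\omega):=\min\{\operatorname{cdim}\omega' : \omega'\sim\omega\}$, where $\omega'$ runs over the states on $\mathcal O_n$, and call $\omega$ minimal if $\operatorname{cdim}\omega=\kappa(\omega)$. For a unit vector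 $z$ of $\mathbb C^n$ (of $\ell^2$ if $n=\infty$), the Cuntz state by $z$ is the state $\omega$ on $\mathcal O_n$ with $\omega(s_j)=\overline{z_j}$ for all $j$. There exist a unique Cuntz state $\omega_+$ by $(1,0,0,\dots)$ and a unique Cuntz state $\omega_-$ by $(-1,0,0,\dots)$, and: (i) There is a pure state on $\mathcal O_n$ that is not minimal, namely $\omega':=\omega_+(s_2^*(\cdot)s_2)$. (ii) There is a minimal state on $\mathcal O_n$ that is not pure, namely $\omega'':=\tfrac12(\omega_++\omega_-)$. -/

import Mathlib

open scoped ComplexOrder InnerProductSpace ENNReal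

noncomputable section

/-! ### States on a unital C⋆-algebra, purity and equivalence -/

/-- A state on a unital C⋆-algebra: a positive linear functional `ω` with `ω 1 = 1`. -/
structure CStarState (A : Type*) [CStarAlgebra A] [PartialOrder A] [StarOrderedRing A]
    extends A →ₚ[ℂ] ℂ where
  map_one : toFun 1 = 1

namespace CStarState

variable {A : Type*} [CStarAlgebra A] [PartialOrder A] [StarOrderedRing A]

instance : FunLike (CStarState A) A ℂ where
  coe ω := ω.toPositiveLinearMap
  coe_injective := by
    rintro ⟨f, hf⟩ ⟨g, hg⟩ h
    obtain rfl : f = g := DFunLike.coe_injective h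
    rfl

/-- The state space of `A`, as a (convex) set of linear functionals. -/
def stateSpace (A : Type*) [CStarAlgebra A] [PartialOrder A] [StarOrderedRing A] :
    Set (A →ₗ[ℂ] ℂ) :=
  Set.range fun φ : CStarState A => φ.toPositiveLinearMap.toLinearMap

/-- A state is pure if it is an extreme point of the state space. -/
def IsPure (ω : CStarState A) : Prop :=
  ω.toPositiveLinearMap.toLinearMap ∈ (stateSpace A).extremePoints ℝ

/-- The GNS Hilbert space of a state. -/
abbrev GNS (ω : CStarState A) : Type _ := ω.toPositiveLinearMap.GNS

/-- The GNS representation of a state. -/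
def gnsRep (ω : CStarState A) : A →⋆ₐ[ℂ] (ω.GNS →L[ℂ] ω.GNS) :=
  ω.toPositiveLinearMap.gnsStarAlgHom

/-- The canonical cyclic vector `Ω` of the GNS representation, the class of the unit. -/
def gnsVector (ω : CStarState A) : ω.GNS :=
  ((ω.toPositiveLinearMap.toPreGNS 1 : ω.toPositiveLinearMap.PreGNS) :
    UniformSpace.Completion ω.toPositiveLinearMap.PreGNS)

/-- `ω ∼ φ`: the GNS representations of `ω` and `φ` are unitarily equivalent. -/
def Equivalent (ω φ : CStarState A) : Prop :=
  ∃ U : ω.GNS ≃ₗᵢ[ℂ] φ.GNS, ∀ (a : A) (x : ω.GNS), U (ω.gnsRep a x) = φ.gnsRep a (U x)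

end CStarState

/-! ### The Cuntz algebra `𝒪ₙ`, `2 ≤ n ≤ ∞` -/

/-- The index set of the generators of `𝒪ₙ`, `n` being finite or infinite. Indices start at `0`:
the index `i` here is the index `i + 1` in the usual numbering `s₁, s₂, …`. -/
abbrev CuntzIndex (n : ℕ∞) : Type := {i : ℕ // (i : ℕ∞) < n}

/-- The index of the first generator `s₁`. -/
def CuntzIndex.first {n : ℕ∞} (hn : 2 ≤ n) : CuntzIndex n :=
  ⟨0, lt_of_lt_of_le (by norm_num) hn⟩

/-- The index of the second generator `s₂`. -/
def CuntzIndex.second {n : ℕ∞} (hn : 2 ≤ n) : CuntzIndex n :=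
  ⟨1, lt_of_lt_of_le (by norm_num) hn⟩

/-- The Cuntz relations for a family `t` in a unital C⋆-algebra: `tᵢ⋆ tⱼ = δᵢⱼ 1`, together with
`∑ᵢ tᵢ tᵢ⋆ = 1` if `n` is finite, and with `∑_{i ∈ F} tᵢ tᵢ⋆ ≤ 1` for all finite `F` if `n = ∞`
(in the order of the C⋆-algebra). -/
structure IsCuntzFamily {n : ℕ∞} {B : Type*} [CStarAlgebra B] (t : CuntzIndex n → B) : Prop where
  star_mul : ∀ i j, star (t i) * t j = if i = j then 1 else 0
  sum_eq_one : n ≠ ⊤ → ∑ᶠ i, t i * star (t i) = 1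
  sum_le_one : n = ⊤ → letI := CStarAlgebra.spectralOrder B
    ∀ F : Finset (CuntzIndex n), ∑ i ∈ F, t i * star (t i) ≤ 1

/-- The third condition follows from the first one. -/
theorem sum_mul_star_le_one {n : ℕ∞} {B : Type*} [CStarAlgebra B] [PartialOrder B]
    [StarOrderedRing B] {t : CuntzIndex n → B}
    (h : ∀ i j, star (t i) * t j = if i = j then 1 else 0) (F : Finset (CuntzIndex n)) :
    ∑ i ∈ F, t i * star (t i) ≤ 1 := by
  have hs : star (∑ i ∈ F, t i * star (t i)) = ∑ i ∈ F, t i * star (t i) := by simp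
  have hp : (∑ i ∈ F, t i * star (t i)) * (∑ i ∈ F, t i * star (t i)) =
      ∑ i ∈ F, t i * star (t i) := by
    rw [Finset.sum_mul_sum]
    refine Finset.sum_congr rfl fun i hi => ?_
    have : ∀ j, t i * star (t i) * (t j * star (t j)) =
        if i = j then t i * star (t j) else 0 := by
      intro j
      rw [mul_assoc, ← mul_assoc (star (t i)), h]
      split_ifs <;> simp
    simp [this, hi]
  have := star_mul_self_nonneg (1 - ∑ i ∈ F, t i * star (t i))
  rw [star_sub, hs, star_one, sub_mul, one_mul, mul_sub, mul_one, hp, sub_self, sub_zero] at this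
  exact sub_nonneg.mp this

/-- A realization of the Cuntz relations in some nonzero unital C⋆-algebra. -/
structure CuntzModel (n : ℕ∞) : Type 1 where
  carrier : Type
  [cstar : CStarAlgebra carrier]
  [nontrivial : Nontrivial carrier]
  gen : CuntzIndex n → carrier
  isCuntz : IsCuntzFamily gen

attribute [instance] CuntzModel.cstar CuntzModel.nontrivial

/-- The `ℓ^∞`-product of all realizations of the Cuntz relations. -/
abbrev CuntzProduct (n : ℕ∞) : Type 1 := lp (fun T : CuntzModel n => T.carrier) ∞

instance (n : ℕ∞) : CStarAlgebra (CuntzProduct n) where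
  __ := (inferInstance : NormedAlgebra ℂ (CuntzProduct n))
  norm_mul_self_le := (inferInstance : CStarRing (CuntzProduct n)).norm_mul_self_le
  star_smul := star_smul
  norm_mul_le := norm_mul_le
  dist_eq := dist_eq_norm_neg_add

theorem IsCuntzFamily.norm_le_one {n : ℕ∞} {B : Type*} [CStarAlgebra B] [Nontrivial B]
    {t : CuntzIndex n → B} (h : IsCuntzFamily t) (i : CuntzIndex n) : ‖t i‖ ≤ 1 := by
  have h1 := CStarRing.norm_star_mul_self (x := t i)
  rw [h.star_mul, if_pos rfl, CStarRing.norm_one] at h1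
  nlinarith [norm_nonneg (t i)]

/-- The family of the `i`-th generators of all realizations. -/
def CuntzProduct.gen {n : ℕ∞} (i : CuntzIndex n) : CuntzProduct n :=
  ⟨fun T => T.gen i, memℓp_infty ⟨1, by
    rintro _ ⟨T, rfl⟩
    exact T.isCuntz.norm_le_one i⟩⟩

/-- The C⋆-subalgebra of the product generated by these families. -/
def cuntzSubalgebra (n : ℕ∞) : StarSubalgebra ℂ (CuntzProduct n) :=
  (StarAlgebra.adjoin ℂ (Set.range (CuntzProduct.gen (n := n)))).topologicalClosure

/-- The Cuntz algebra `𝒪ₙ`: the universal unital C⋆-algebra generated by a family satisfying the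
Cuntz relations (see `CuntzAlgebra.isCuntzFamily`, `CuntzAlgebra.adjoin_topologicalClosure` and
`CuntzAlgebra.exists_lift`). C⋆-algebras generated by countably many elements have at most
continuum many elements, so realizations in `Type` are all of them up to isomorphism. -/
def CuntzAlgebra (n : ℕ∞) : Type 1 := cuntzSubalgebra n

namespace CuntzAlgebra

instance (n : ℕ∞) : IsClosed (cuntzSubalgebra n : Set (CuntzProduct n)) :=
  StarSubalgebra.isClosed_topologicalClosure _

instance (n : ℕ∞) : CStarAlgebra (CuntzAlgebra n) :=
  inferInstanceAs (CStarAlgebra (cuntzSubalgebra n))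

/-- The order of the C⋆-algebra `𝒪ₙ`. -/
instance (n : ℕ∞) : PartialOrder (CuntzAlgebra n) := CStarAlgebra.spectralOrder _

instance (n : ℕ∞) : StarOrderedRing (CuntzAlgebra n) := CStarAlgebra.spectralOrderedRing _

/-- The Cuntz generators of `𝒪ₙ`. -/
def s {n : ℕ∞} (i : CuntzIndex n) : CuntzAlgebra n :=
  (⟨CuntzProduct.gen i, StarSubalgebra.le_topologicalClosure _
    (StarAlgebra.subset_adjoin ℂ _ ⟨i, rfl⟩)⟩ : cuntzSubalgebra n)

/-- The inclusion of `𝒪ₙ` into the product of all realizations. -/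
def incl (n : ℕ∞) : CuntzAlgebra n →⋆ₐ[ℂ] CuntzProduct n := (cuntzSubalgebra n).subtype

theorem incl_injective (n : ℕ∞) : Function.Injective (incl n) := Subtype.val_injective

theorem incl_s {n : ℕ∞} (i : CuntzIndex n) : incl n (s i) = CuntzProduct.gen i := rfl

end CuntzAlgebra

namespace CuntzProduct

/-- The projection of the product onto one of its factors. -/
def proj {n : ℕ∞} (T : CuntzModel n) : CuntzProduct n →⋆ₐ[ℂ] T.carrier where
  toFun x := x T
  map_one' := rfl
  map_mul' _ _ := rfl
  map_zero' := rfl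
  map_add' _ _ := rfl
  commutes' _ := rfl
  map_star' _ := rfl

theorem ext_proj {n : ℕ∞} {x y : CuntzProduct n} (h : ∀ T, proj T x = proj T y) : x = y :=
  lp.ext (funext h)

end CuntzProduct

namespace CuntzAlgebra

theorem proj_s {n : ℕ∞} (T : CuntzModel n) (i : CuntzIndex n) :
    CuntzProduct.proj T (incl n (s i)) = T.gen i := rfl

/-- The generators of `𝒪ₙ` satisfy the Cuntz relations. -/
theorem isCuntzFamily (n : ℕ∞) : IsCuntzFamily (s (n := n)) := by
  have h1 : ∀ i j : CuntzIndex n, star (s i) * s j = if i = j then 1 else 0 := by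
    intro i j
    apply incl_injective
    apply CuntzProduct.ext_proj
    intro T
    rw [map_mul, map_mul, map_star, map_star, proj_s, proj_s, T.isCuntz.star_mul]
    split_ifs <;> simp
  refine ⟨h1, fun hn => ?_, fun _ F => sum_mul_star_le_one h1 F⟩
  have : Finite (CuntzIndex n) := by
    lift n to ℕ using hn
    exact Set.Finite.to_subtype ((Set.finite_lt_nat n).subset fun i hi => by
      simpa using (show ((i : ℕ) : ℕ∞) < (n : ℕ∞) from hi))
  have := Fintype.ofFinite (CuntzIndex n)
  apply incl_injective
  apply CuntzProduct.ext_proj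
  intro T
  have h2 := T.isCuntz.sum_eq_one hn
  rw [finsum_eq_sum_of_fintype] at h2 ⊢
  simp only [map_sum, map_mul, map_star, proj_s, map_one, h2]

/-- `𝒪ₙ` is generated by `s` as a C⋆-algebra. -/
theorem adjoin_topologicalClosure (n : ℕ∞) :
    (StarAlgebra.adjoin ℂ (Set.range (s (n := n)))).topologicalClosure = ⊤ := by
  refine top_le_iff.mp fun x _ => ?_
  have hind : Topology.IsInducing (incl n) := Topology.IsInducing.subtypeVal
  have hmap : (StarAlgebra.adjoin ℂ (Set.range (s (n := n)))).map (incl n) =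
      StarAlgebra.adjoin ℂ (Set.range (CuntzProduct.gen (n := n))) := by
    rw [StarAlgHom.map_adjoin, ← Set.range_comp]
    rfl
  change x ∈ closure ((StarAlgebra.adjoin ℂ (Set.range (s (n := n))) :
    StarSubalgebra ℂ (CuntzAlgebra n)) : Set (CuntzAlgebra n))
  rw [hind.closure_eq_preimage_closure_image]
  have hx : incl n x ∈ closure ((StarAlgebra.adjoin ℂ (Set.range (CuntzProduct.gen (n := n))) :
    StarSubalgebra ℂ (CuntzProduct n)) : Set (CuntzProduct n)) := x.2
  rw [← hmap] at hx
  exact hx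

/-- The universal property: every family satisfying the Cuntz relations in a unital C⋆-algebra is
the image of `s` under a unital ⋆-homomorphism (which is unique, as `s` generates `𝒪ₙ`). -/
theorem exists_lift {n : ℕ∞} {B : Type} [CStarAlgebra B] (t : CuntzIndex n → B)
    (ht : IsCuntzFamily t) : ∃ f : CuntzAlgebra n →⋆ₐ[ℂ] B, ∀ i, f (s i) = t i := by
  rcases subsingleton_or_nontrivial B with h | h
  · exact ⟨{ toFun := fun _ => 0
             map_one' := Subsingleton.elim _ _
             map_mul' := fun _ _ => Subsingleton.elim _ _
             map_zero' := rfl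
             map_add' := fun _ _ => Subsingleton.elim _ _
             commutes' := fun _ => Subsingleton.elim _ _
             map_star' := fun _ => Subsingleton.elim _ _ }, fun _ => Subsingleton.elim _ _⟩
  · exact ⟨(CuntzProduct.proj (⟨B, t, ht⟩ : CuntzModel n)).comp (incl n), fun _ => rfl⟩

/-- The word `s_J = s_{j₁} ⋯ s_{jₗ}` for `J = (j₁, …, jₗ)`, with `s_∅ = 1`. -/
def word {n : ℕ∞} (J : List (CuntzIndex n)) : CuntzAlgebra n := (J.map s).prod

end CuntzAlgebra

/-! ### The invariant `κ` and minimal states -/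

namespace CStarState

variable {n : ℕ∞}

/-- `𝒦(ω)`: the closed linear span of the vectors `π(s_J)⋆ Ω`, `J` ranging over all finite words,
in the GNS representation `(ℋ, π, Ω)` of `ω`. -/
def corrSpace (ω : CStarState (CuntzAlgebra n)) : Submodule ℂ ω.GNS :=
  (Submodule.span ℂ (Set.range fun J : List (CuntzIndex n) =>
    ContinuousLinearMap.adjoint (ω.gnsRep (CuntzAlgebra.word J)) ω.gnsVector)).topologicalClosure

/-- `cdim ω = dim 𝒦(ω) ∈ {1, 2, …, ∞}`, where `∞` stands for infinite dimension (`𝒦(ω)` is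
separable, so all infinite Hilbert space dimensions agree). -/
def cdim (ω : CStarState (CuntzAlgebra n)) : ℕ∞ :=
  Cardinal.toENat (Module.rank ℂ ω.corrSpace)

/-- `κ(ω)`: the least value of `cdim` on the states equivalent to `ω`. -/
def kappa (ω : CStarState (CuntzAlgebra n)) : ℕ∞ :=
  sInf {d | ∃ φ : CStarState (CuntzAlgebra n), φ.Equivalent ω ∧ φ.cdim = d}

/-- A state on `𝒪ₙ` is minimal if `cdim ω = κ(ω)`. -/
def IsMinimal (ω : CStarState (CuntzAlgebra n)) : Prop := ω.cdim = ω.kappa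

/-- `ω` is a Cuntz state by the unit vector `z` of `ℂⁿ` (of `ℓ²` if `n = ∞`):
`ω(s_j)` is the complex conjugate of `z_j` for all `j`. -/
def IsCuntzState (ω : CStarState (CuntzAlgebra n)) (z : lp (fun _ : CuntzIndex n => ℂ) 2) : Prop :=
  ‖z‖ = 1 ∧ ∀ j, ω (CuntzAlgebra.s j) = star (z j)

end CStarState

end

/-! If a state `ω` takes a value `c` of modulus 1 at a contraction `v`, the equality case of
Cauchy–Schwarz gives π(v)Ω = cΩ (`gnsRep_gnsVector_eq_smul`). For v = s_i this makes Ω a joint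
eigenvector of all π(s_j)⋆. Since the elements s_I s_J⋆ span a dense subspace (`dense_normalSpan`),
the value at s_i determines the state (`eq_of_apply_s_eq`), and 𝒦(ω) = ℂΩ. Such states exist as
vector states of a constant sequence in the shift representation, with the generators rotated by
`c`.

(i) The state ω' = ω₊(s₂⋆ · s₂) is equivalent to ω₊, so κ(ω') ≤ 1. It is pure because it is the only
state with value 1 at the partial isometry s₂s₁s₂⋆. If cdim ω' ≤ 1, then π(s₂)⋆Ω' = dΩ' with d =
ω'(s₂⋆) = 0, whereas this vector has norm 1.

(ii) In the GNS space of ω'' = (ω₊ + ω₋)/2, Ω is half the sum of two eigenvectors of π(s₁), with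
eigenvalues 1 and -1. Their span contains 𝒦(ω''), so cdim ω'' ≤ 2. Both eigenvalues survive in every
equivalent representation, and there `one_lt_cdim_of_eigenvectors` excludes cdim ≤ 1. The state is
not pure because ω₊ ≠ ω₋. -/

noncomputable section

/-! ### States and their GNS representations -/

namespace CStarState

variable {A : Type*} [CStarAlgebra A] [PartialOrder A] [StarOrderedRing A]

instance : LinearMapClass (CStarState A) ℂ A ℂ where
  map_add ω := map_add ω.toPositiveLinearMap
  map_smulₛₗ ω := map_smul ω.toPositiveLinearMap

instance : OrderHomClass (CStarState A) A ℂ where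
  map_rel ω _ _ h := ω.toPositiveLinearMap.monotone' h

@[ext] theorem ext {ω φ : CStarState A} (h : ∀ x, ω x = φ x) : ω = φ :=
  DFunLike.ext _ _ h

theorem apply_one (ω : CStarState A) : ω 1 = 1 := ω.map_one

theorem apply_star (ω : CStarState A) (a : A) : ω (star a) = star (ω a) :=
  map_star ω.toPositiveLinearMap a

/-- A linear functional which is nonnegative on the elements `a⋆ a` and maps `1` to `1`, as a
state. -/
def ofLinearMap (f : A →ₗ[ℂ] ℂ) (hf : ∀ a, 0 ≤ f (star a * a)) (h1 : f 1 = 1) : CStarState A where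
  toPositiveLinearMap := PositiveLinearMap.mk₀ f fun x hx => by
    obtain ⟨a, rfl⟩ := CStarAlgebra.nonneg_iff_eq_star_mul_self.mp hx
    exact hf a
  map_one := h1

theorem apply_star_mul_self_nonneg (ω : CStarState A) (a : A) : 0 ≤ ω (star a * a) :=
  ω.toPositiveLinearMap.map_nonneg (star_mul_self_nonneg a)

/-- The state `x ↦ ω (t⋆ x t)`, where `ω (t⋆ t) = 1`. -/
def conj (ω : CStarState A) (t : A) (ht : ω (star t * t) = 1) : CStarState A :=
  ofLinearMap (ω.toPositiveLinearMap.toLinearMap ∘ₗ LinearMap.mulLeft ℂ (star t) ∘ₗ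
      LinearMap.mulRight ℂ t)
    (fun a => by
      have := ω.apply_star_mul_self_nonneg (a * t)
      rw [star_mul] at this
      simpa [mul_assoc] using! this)
    (by simpa using! ht)

@[simp] theorem conj_apply (ω : CStarState A) (t : A) (ht : ω (star t * t) = 1) (x : A) :
    ω.conj t ht x = ω (star t * x * t) := by
  rw [mul_assoc]; rfl

/-- The average of two states. -/
def average (ω φ : CStarState A) : CStarState A :=
  ofLinearMap ((1 / 2 : ℂ) • (ω.toPositiveLinearMap.toLinearMap + φ.toPositiveLinearMap.toLinearMap))
    (fun a => mul_nonneg (by norm_num [Complex.le_def])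
      (add_nonneg (ω.apply_star_mul_self_nonneg a) (φ.apply_star_mul_self_nonneg a)))
    (by
      change (1 / 2 : ℂ) * (ω 1 + φ 1) = 1
      rw [apply_one, apply_one]; norm_num)

@[simp] theorem average_apply (ω φ : CStarState A) (x : A) :
    ω.average φ x = (ω x + φ x) / 2 := by
  change (1 / 2 : ℂ) * (ω x + φ x) = _
  ring

/-- The vector state of a unit vector in a representation. -/
def ofVector {H : Type*} [NormedAddCommGroup H] [InnerProductSpace ℂ H] [CompleteSpace H]
    (π : A →⋆ₐ[ℂ] (H →L[ℂ] H)) (ξ : H) (hξ : ‖ξ‖ = 1) : CStarState A :=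
  ofLinearMap
    { toFun := fun a => ⟪ξ, π a ξ⟫_ℂ
      map_add' := fun a b => by simp
      map_smul' := fun c a => by simp }
    (fun a => by
      simp only [LinearMap.coe_mk, AddHom.coe_mk, map_mul, map_star,
        ContinuousLinearMap.star_eq_adjoint, mul_apply_eq_comp,
        ContinuousLinearMap.adjoint_inner_right]
      rw [inner_self_eq_norm_sq_to_K]
      simp only [Complex.coe_algebraMap]
      positivity)
    (by simp [inner_self_eq_norm_sq_to_K, hξ])

@[simp] theorem ofVector_apply {H : Type*} [NormedAddCommGroup H] [InnerProductSpace ℂ H]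
    [CompleteSpace H] (π : A →⋆ₐ[ℂ] (H →L[ℂ] H)) (ξ : H) (hξ : ‖ξ‖ = 1) (a : A) :
    ofVector π ξ hξ a = ⟪ξ, π a ξ⟫_ℂ := rfl

theorem gnsRep_gnsVector (ω : CStarState A) (a : A) :
    ω.gnsRep a ω.gnsVector =
      ((ω.toPositiveLinearMap.toPreGNS a : ω.toPositiveLinearMap.PreGNS) : ω.GNS) := by
  refine (PositiveLinearMap.gnsNonUnitalStarAlgHom_apply_coe _).trans ?_
  rw [PositiveLinearMap.leftMulMapPreGNS_apply]
  simp

theorem inner_gnsRep_gnsVector (ω : CStarState A) (a b : A) :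
    ⟪ω.gnsRep a ω.gnsVector, ω.gnsRep b ω.gnsVector⟫_ℂ = ω (star a * b) := by
  rw [gnsRep_gnsVector, gnsRep_gnsVector, UniformSpace.Completion.inner_coe,
    PositiveLinearMap.preGNS_inner_def]
  rfl

theorem inner_gnsVector (ω : CStarState A) (a : A) :
    ⟪ω.gnsVector, ω.gnsRep a ω.gnsVector⟫_ℂ = ω a := by
  simpa using ω.inner_gnsRep_gnsVector 1 a

theorem norm_gnsRep_gnsVector_sq (ω : CStarState A) (a : A) :
    ((‖ω.gnsRep a ω.gnsVector‖ ^ 2 : ℝ) : ℂ) = ω (star a * a) := by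
  rw [← inner_gnsRep_gnsVector, inner_self_eq_norm_sq_to_K]
  simp

theorem norm_gnsVector (ω : CStarState A) : ‖ω.gnsVector‖ = 1 := by
  have := ω.norm_gnsRep_gnsVector_sq 1
  rw [_root_.map_one, star_one, mul_one, apply_one, one_apply_eq_self] at this
  norm_cast at this
  exact (pow_eq_one_iff_of_nonneg (norm_nonneg _) two_ne_zero).mp this

theorem gnsVector_ne_zero (ω : CStarState A) : ω.gnsVector ≠ 0 := by
  intro h
  simpa [h] using ω.norm_gnsVector

/-- The GNS vector is cyclic. -/
theorem denseRange_gnsRep_gnsVector (ω : CStarState A) :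
    DenseRange fun a => ω.gnsRep a ω.gnsVector := by
  simp_rw [gnsRep_gnsVector]
  exact (UniformSpace.Completion.denseRange_coe (α := ω.toPositiveLinearMap.PreGNS)).comp
    ω.toPositiveLinearMap.toPreGNS.surjective.denseRange
    (UniformSpace.Completion.continuous_coe _)

theorem Equivalent.refl (ω : CStarState A) : ω.Equivalent ω :=
  ⟨LinearIsometryEquiv.refl ℂ _, fun _ _ => rfl⟩

/-- The vector π(t)Ω is again cyclic, because every `a` equals (a t⋆)t, and it induces the
conjugated state. Hence π(a)π(t)Ω ↦ π'(a)Ω' extends to an intertwining unitary. -/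
theorem equivalent_conj (ω : CStarState A) (t : A) (ht : star t * t = 1) (h) :
    ω.Equivalent (ω.conj t h) := by
  let e₁ : A →ₗ[ℂ] ω.GNS :=
    { toFun := fun a => ω.gnsRep (a * t) ω.gnsVector
      map_add' := fun a b => by simp [add_mul]
      map_smul' := fun c a => by simp }
  let e₂ : A →ₗ[ℂ] (ω.conj t h).GNS :=
    { toFun := fun a => (ω.conj t h).gnsRep a (ω.conj t h).gnsVector
      map_add' := fun a b => by simp
      map_smul' := fun c a => by simp }
  have h₁ : DenseRange e₁ := by
    have : Function.Surjective fun a => a * t := fun a =>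
      ⟨a * star t, by simp [mul_assoc, ht]⟩
    intro x
    have hx := ω.denseRange_gnsRep_gnsVector x
    rwa [← this.range_comp] at hx
  have h₂ : DenseRange e₂ := denseRange_gnsRep_gnsVector _
  have hn : ∀ a, ‖e₂ (LinearEquiv.refl ℂ A a)‖ = ‖e₁ a‖ := by
    intro a
    rw [← sq_eq_sq₀ (norm_nonneg _) (norm_nonneg _), ← Complex.ofReal_inj]
    refine (norm_gnsRep_gnsVector_sq _ _).trans ((?_ : _ = _).trans
      (norm_gnsRep_gnsVector_sq _ _).symm)
    rw [conj_apply, star_mul]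
    simp only [LinearEquiv.refl_apply, mul_assoc]
  refine ⟨(LinearEquiv.refl ℂ A).extendOfIsometry e₁ e₂ h₁ h₂ hn, fun a => ?_⟩
  refine h₁.induction ?_ (isClosed_eq (by fun_prop) (by fun_prop))
  rintro _ ⟨b, rfl⟩
  have : ω.gnsRep a (e₁ b) = e₁ (a * b) := by simp [e₁]
  rw [this, LinearEquiv.extendOfIsometry_eq, LinearEquiv.extendOfIsometry_eq]
  simp [e₂]

theorem Equivalent.symm {ω φ : CStarState A} (h : ω.Equivalent φ) : φ.Equivalent ω := by
  obtain ⟨U, hU⟩ := h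
  refine ⟨U.symm, fun a x => ?_⟩
  rw [LinearIsometryEquiv.symm_apply_eq, hU, LinearIsometryEquiv.apply_symm_apply]

/-! ### Contractions at which a state has modulus 1 -/

theorem norm_gnsRep_gnsVector_le_one (ω : CStarState A) {v : A} (hv : star v * v ≤ 1) :
    ‖ω.gnsRep v ω.gnsVector‖ ≤ 1 := by
  have h : ω (star v * v) ≤ ω 1 := OrderHomClass.mono ω hv
  rw [← norm_gnsRep_gnsVector_sq, apply_one] at h
  norm_cast at h
  exact (sq_le_one_iff₀ (norm_nonneg _)).mp h

theorem norm_apply_le_one (ω : CStarState A) {v : A} (hv : star v * v ≤ 1) : ‖ω v‖ ≤ 1 := by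
  rw [← inner_gnsVector]
  refine (norm_inner_le_norm _ _).trans ?_
  rw [norm_gnsVector, one_mul]
  exact ω.norm_gnsRep_gnsVector_le_one hv

/-- A contraction on which the state takes a value of modulus `1` acts on the GNS vector as a
scalar. -/
theorem gnsRep_gnsVector_eq_smul (ω : CStarState A) {v : A} (hv : star v * v ≤ 1) {c : ℂ}
    (hc : ‖c‖ = 1) (h : ω v = c) : ω.gnsRep v ω.gnsVector = c • ω.gnsVector := by
  have hv1 := ω.norm_gnsRep_gnsVector_le_one hv
  rw [← sub_eq_zero, ← norm_eq_zero, ← sq_eq_zero_iff]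
  refine le_antisymm ?_ (sq_nonneg _)
  -- With this, ‖vΩ - cΩ‖² = ‖vΩ‖² - 2 + 1, which is at most 0.
  have key : ⟪ω.gnsRep v ω.gnsVector, c • ω.gnsVector⟫_ℂ = 1 := by
    rw [inner_smul_right, ← inner_conj_symm, inner_gnsVector, h, Complex.mul_conj,
      Complex.normSq_eq_norm_sq, hc]
    norm_num
  rw [norm_sub_sq (𝕜 := ℂ), key, norm_smul, hc, norm_gnsVector]
  simp only [RCLike.one_re]
  nlinarith [norm_nonneg (ω.gnsRep v ω.gnsVector)]

theorem apply_mul_right (ω : CStarState A) {v : A} (hv : star v * v ≤ 1) {c : ℂ}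
    (hc : ‖c‖ = 1) (h : ω v = c) (x : A) : ω (x * v) = c * ω x := by
  rw [← inner_gnsVector, ← inner_gnsVector, map_mul, mul_apply_eq_comp,
    ω.gnsRep_gnsVector_eq_smul hv hc h, map_smul, inner_smul_right]

theorem apply_star_mul_left (ω : CStarState A) {v : A} (hv : star v * v ≤ 1) {c : ℂ}
    (hc : ‖c‖ = 1) (h : ω v = c) (x : A) : ω (star v * x) = star c * ω x := by
  have := ω.apply_mul_right hv hc h (star x)
  rw [← star_inj, ← apply_star]
  simp [apply_star] at this ⊢
  rw [this]

/-- A state is pure if it is determined by the value `1` on some contraction. -/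
theorem isPure_of_forall_eq (ω : CStarState A) {v : A} (hv : star v * v ≤ 1) (h1 : ω v = 1)
    (h : ∀ φ : CStarState A, φ v = 1 → φ = ω) : ω.IsPure := by
  refine ⟨⟨ω, rfl⟩, ?_⟩
  rintro _ ⟨φ, rfl⟩ _ ⟨ψ, rfl⟩ ⟨a, b, ha, hb, hab, hω⟩
  -- The number 1 is an extreme point of the closed unit disc, and both weights are positive, so
  -- φ(v) = 1.
  have e : a * φ v + b * ψ v = 1 := by
    rw [← h1]
    exact congrArg (fun f : A →ₗ[ℂ] ℂ => f v) hω
  have hφ := φ.norm_apply_le_one hv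
  have hψ := ψ.norm_apply_le_one hv
  have er : a * (φ v).re + b * (ψ v).re = 1 := by simpa using congrArg Complex.re e
  have h1' := (Complex.re_le_norm (φ v)).trans hφ
  have h2' := (Complex.re_le_norm (ψ v)).trans hψ
  have hre : (φ v).re = 1 := by nlinarith
  have hn : ‖φ v‖ = 1 := le_antisymm hφ (hre ▸ Complex.re_le_norm _)
  have him : (φ v).im = 0 := by
    have := Complex.sq_norm (φ v)
    rw [hn, Complex.normSq_apply, hre] at this
    nlinarith
  have : φ = ω := h φ (Complex.ext (by simpa using hre) (by simpa using him))
  rw [this]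

theorem not_isPure_average {ω φ : CStarState A} (h : ω ≠ φ) : ¬ (ω.average φ).IsPure := by
  intro hp
  have h1 := hp.2 ⟨ω, rfl⟩ ⟨φ, rfl⟩ ⟨1 / 2, 1 / 2, by norm_num, by norm_num, by norm_num, by
    ext x
    change (1 / 2 : ℝ) • ω x + (1 / 2 : ℝ) • φ x = ω.average φ x
    rw [average_apply]
    simp
    ring⟩
  refine h (ext fun x => ?_)
  have h2 : ω x = ω.average φ x := congrArg (fun f : A →ₗ[ℂ] ℂ => f x) h1
  rw [average_apply] at h2
  linear_combination 2 * h2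

end CStarState

/-! ### Words and states on the Cuntz algebra -/

namespace CuntzAlgebra

variable {n : ℕ∞}

@[simp] theorem word_nil : word ([] : List (CuntzIndex n)) = 1 := rfl

@[simp] theorem word_cons (i : CuntzIndex n) (J : List (CuntzIndex n)) :
    word (i :: J) = s i * word J := by
  simp [word]

theorem word_append (I J : List (CuntzIndex n)) : word (I ++ J) = word I * word J := by
  simp [word]

theorem star_s_mul_s (i j : CuntzIndex n) : star (s i) * s j = if i = j then 1 else 0 :=
  (isCuntzFamily n).star_mul i j

theorem star_s_mul_s_self (i : CuntzIndex n) : star (s i) * s i = 1 := by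
  simp [star_s_mul_s]

theorem star_s_mul_s_self_le_one (i : CuntzIndex n) : star (s i) * s i ≤ 1 :=
  (star_s_mul_s_self i).le

theorem s_mul_star_s_le_one (i : CuntzIndex n) : s i * star (s i) ≤ 1 := by
  simpa using sum_mul_star_le_one (t := s (n := n)) star_s_mul_s {i}

/-- The linear span of the elements `s_I s_J⋆`. -/
def normalSpan (n : ℕ∞) : Submodule ℂ (CuntzAlgebra n) :=
  Submodule.span ℂ {x | ∃ I J, x = word I * star (word J)}

theorem word_mul_star_word_mem (I J : List (CuntzIndex n)) :
    word I * star (word J) ∈ normalSpan n :=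
  Submodule.subset_span ⟨I, J, rfl⟩

theorem mul_mem_normalSpan_of_forall {a : CuntzAlgebra n}
    (h : ∀ I J, a * (word I * star (word J)) ∈ normalSpan n) {x : CuntzAlgebra n}
    (hx : x ∈ normalSpan n) : a * x ∈ normalSpan n := by
  have : normalSpan n ≤ (normalSpan n).comap (LinearMap.mulLeft ℂ a) :=
    Submodule.span_le.mpr (by rintro _ ⟨I, J, rfl⟩; exact h I J)
  exact this hx

theorem s_mul_mem_normalSpan (i : CuntzIndex n) {x : CuntzAlgebra n} (hx : x ∈ normalSpan n) :
    s i * x ∈ normalSpan n := by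
  refine mul_mem_normalSpan_of_forall (fun I J => ?_) hx
  rw [← mul_assoc, ← word_cons]
  exact word_mul_star_word_mem _ _

/-- On s_I s_J⋆, the factor s_i⋆ meets the first letter of `I`, which it cancels or annihilates. If
`I` is empty, it is absorbed into s_J⋆ as a new last letter of `J`. -/
theorem star_s_mul_mem_normalSpan (i : CuntzIndex n) {x : CuntzAlgebra n}
    (hx : x ∈ normalSpan n) : star (s i) * x ∈ normalSpan n := by
  refine mul_mem_normalSpan_of_forall (fun I J => ?_) hx
  cases I with
  | nil =>
    have : star (s i) * (word [] * star (word J)) = word [] * star (word (J ++ [i])) := by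
      simp [word_append]
    rw [this]
    exact word_mul_star_word_mem _ _
  | cons k I =>
    rw [word_cons, mul_assoc, ← mul_assoc (star (s i)), star_s_mul_s]
    split_ifs
    · simpa using word_mul_star_word_mem I J
    · simp

theorem adjoin_subset_normalSpan :
    ((StarAlgebra.adjoin ℂ (Set.range (s (n := n))) : StarSubalgebra ℂ (CuntzAlgebra n)) :
      Set (CuntzAlgebra n)) ⊆ normalSpan n := by
  intro a ha
  have h1 : (1 : CuntzAlgebra n) ∈ normalSpan n := by simpa using word_mul_star_word_mem [] []
  -- Tracking `a` and `star a` together makes the condition stable under the adjoint, so that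
  -- induction over the ⋆-algebra goes through.
  suffices h : (∀ x ∈ normalSpan n, a * x ∈ normalSpan n) ∧
      ∀ x ∈ normalSpan n, star a * x ∈ normalSpan n by simpa using h.1 1 h1
  induction ha using StarAlgebra.adjoin_induction with
  | mem x hx =>
    obtain ⟨i, rfl⟩ := hx
    exact ⟨fun x => s_mul_mem_normalSpan i, fun x => star_s_mul_mem_normalSpan i⟩
  | algebraMap r =>
    simp only [Algebra.algebraMap_eq_smul_one, star_smul, star_one, smul_mul_assoc, one_mul]
    exact ⟨fun x hx => Submodule.smul_mem _ _ hx, fun x hx => Submodule.smul_mem _ _ hx⟩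
  | add x y _ _ hx hy =>
    simp only [star_add, add_mul]
    exact ⟨fun z hz => add_mem (hx.1 z hz) (hy.1 z hz), fun z hz => add_mem (hx.2 z hz) (hy.2 z hz)⟩
  | mul x y _ _ hx hy =>
    simp only [star_mul, mul_assoc]
    exact ⟨fun z hz => hx.1 _ (hy.1 z hz), fun z hz => hy.2 _ (hx.2 z hz)⟩
  | star x _ hx =>
    rw [star_star]
    exact hx.symm

theorem dense_normalSpan : Dense (normalSpan n : Set (CuntzAlgebra n)) := by
  refine Dense.mono adjoin_subset_normalSpan (dense_iff_closure_eq.mpr ?_)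
  have := congrArg (fun S : StarSubalgebra ℂ (CuntzAlgebra n) => (S : Set (CuntzAlgebra n)))
    (adjoin_topologicalClosure n)
  simpa using this

/-- Continuous functionals that agree on the elements `s_I s_J⋆` are equal. -/
theorem linearMap_ext {f g : CuntzAlgebra n →ₗ[ℂ] ℂ} (hf : Continuous f) (hg : Continuous g)
    (h : ∀ I J, f (word I * star (word J)) = g (word I * star (word J))) : f = g := by
  have : (⟨f, hf⟩ : CuntzAlgebra n →L[ℂ] ℂ) = ⟨g, hg⟩ :=
    ContinuousLinearMap.ext_on (s := {x | ∃ I J, x = word I * star (word J)}) dense_normalSpan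
      (by rintro _ ⟨I, J, rfl⟩; exact h I J)
  exact congrArg ContinuousLinearMap.toLinearMap this

section Representation

variable {H : Type*} [NormedAddCommGroup H] [InnerProductSpace ℂ H] [CompleteSpace H]
  (π : CuntzAlgebra n →⋆ₐ[ℂ] (H →L[ℂ] H)) {ξ : H}

/-- Applying s_j⋆ to s_i ξ = cξ shows that an eigenvector of a single generator is a joint
eigenvector of all adjoints. -/
theorem map_star_s_apply {i : CuntzIndex n} {c : ℂ} (hc : c ≠ 0) (h : π (s i) ξ = c • ξ)
    (j : CuntzIndex n) : π (star (s j)) ξ = (if j = i then c⁻¹ else 0 : ℂ) • ξ := by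
  have h1 : π (star (s j)) (c • ξ) = π (star (s j) * s i) ξ := by
    rw [map_mul, mul_apply_eq_comp, h]
  rw [map_smul, ← eq_inv_smul_iff₀ hc, star_s_mul_s] at h1
  rw [h1]
  split_ifs <;> simp

theorem map_star_word_apply {d : CuntzIndex n → ℂ} (h : ∀ j, π (star (s j)) ξ = d j • ξ)
    (J : List (CuntzIndex n)) : π (star (word J)) ξ = (J.map d).prod • ξ := by
  induction J with
  | nil => simp
  | cons j J ih =>
    rw [word_cons, star_mul, map_mul, mul_apply_eq_comp, h, map_smul, ih, smul_smul]
    simp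

end Representation

end CuntzAlgebra

namespace CStarState

open CuntzAlgebra

variable {n : ℕ∞}

/-! ### States of modulus 1 at a generator -/

theorem gnsRep_s_gnsVector (ω : CStarState (CuntzAlgebra n)) {i : CuntzIndex n} {c : ℂ}
    (hc : ‖c‖ = 1) (h : ω (s i) = c) : ω.gnsRep (s i) ω.gnsVector = c • ω.gnsVector :=
  ω.gnsRep_gnsVector_eq_smul (star_s_mul_s_self_le_one i) hc h

theorem gnsRep_star_s_gnsVector (ω : CStarState (CuntzAlgebra n)) {i : CuntzIndex n} {c : ℂ}
    (hc : ‖c‖ = 1) (h : ω (s i) = c) (j : CuntzIndex n) :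
    ω.gnsRep (star (s j)) ω.gnsVector = (if j = i then c⁻¹ else 0 : ℂ) • ω.gnsVector :=
  map_star_s_apply _ (norm_ne_zero_iff.mp (by simp [hc])) (ω.gnsRep_s_gnsVector hc h) j

theorem apply_word_mul_star_word (ω : CStarState (CuntzAlgebra n)) (I J : List (CuntzIndex n)) :
    ω (word I * star (word J)) = ⟪ω.gnsRep (star (word I)) ω.gnsVector,
      ω.gnsRep (star (word J)) ω.gnsVector⟫_ℂ := by
  rw [inner_gnsRep_gnsVector, star_star]

/-- A state is determined by its value at a generator if this value has modulus `1`. -/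
theorem eq_of_apply_s_eq {ω φ : CStarState (CuntzAlgebra n)} {i : CuntzIndex n} {c : ℂ}
    (hc : ‖c‖ = 1) (hω : ω (s i) = c) (hφ : φ (s i) = c) : ω = φ := by
  have : ω.toPositiveLinearMap.toLinearMap = φ.toPositiveLinearMap.toLinearMap := by
    -- Both values at s_I s_J⋆ are inner products of scalar multiples of unit vectors, with scalars
    -- depending only on `i`, `c`, `I` and `J`.
    refine linearMap_ext (map_continuous ω) (map_continuous φ) fun I J => ?_
    change ω _ = φ _
    simp only [apply_word_mul_star_word,
      map_star_word_apply _ (ω.gnsRep_star_s_gnsVector hc hω),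
      map_star_word_apply _ (φ.gnsRep_star_s_gnsVector hc hφ), inner_smul_left, inner_smul_right,
      inner_self_eq_norm_sq_to_K, norm_gnsVector]
  exact ext fun x => congrArg (fun f : CuntzAlgebra n →ₗ[ℂ] ℂ => f x) this

theorem apply_s_of_ne (ω : CStarState (CuntzAlgebra n)) {i j : CuntzIndex n} {c : ℂ}
    (hc : ‖c‖ = 1) (h : ω (s i) = c) (hj : j ≠ i) : ω (s j) = 0 := by
  rw [← star_eq_zero, ← apply_star, ← inner_gnsVector, ω.gnsRep_star_s_gnsVector hc h, if_neg hj]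
  simp

/-- One coordinate of modulus 1 already forces the other generators to have value 0. -/
theorem isCuntzState_single_iff (ω : CStarState (CuntzAlgebra n)) {i : CuntzIndex n} {c : ℂ}
    (hc : ‖c‖ = 1) : ω.IsCuntzState (lp.single 2 i c) ↔ ω (s i) = star c := by
  refine ⟨fun h => by simpa [lp.single_apply] using h.2 i, fun h => ⟨?_, fun j => ?_⟩⟩
  · rw [lp.norm_single (by norm_num), hc]
  · by_cases hj : j = i
    · subst hj
      simpa [lp.single_apply] using h
    · rw [ω.apply_s_of_ne (by simpa using hc) h hj, lp.single_apply_ne _ _ _ hj, star_zero]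

/-! ### Bounds for `cdim` -/

theorem adjoint_gnsRep (ω : CStarState (CuntzAlgebra n)) (a : CuntzAlgebra n) :
    ContinuousLinearMap.adjoint (ω.gnsRep a) = ω.gnsRep (star a) := by
  rw [map_star, ContinuousLinearMap.star_eq_adjoint]

theorem gnsRep_star_word_mem_corrSpace (ω : CStarState (CuntzAlgebra n))
    (J : List (CuntzIndex n)) : ω.gnsRep (star (word J)) ω.gnsVector ∈ ω.corrSpace :=
  Submodule.le_topologicalClosure _ (Submodule.subset_span ⟨J, by simp only [adjoint_gnsRep]⟩)

/-- A finite-dimensional span is closed, so it also contains the closure that defines 𝒦(ω). -/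
theorem cdim_le_card (ω : CStarState (CuntzAlgebra n)) (S : Finset ω.GNS)
    (h : ∀ J, ω.gnsRep (star (word J)) ω.gnsVector ∈ Submodule.span ℂ (S : Set ω.GNS)) :
    ω.cdim ≤ S.card := by
  have hle : ω.corrSpace ≤ Submodule.span ℂ (S : Set ω.GNS) := by
    refine Submodule.topologicalClosure_minimal _ (Submodule.span_le.mpr ?_)
      (Submodule.closed_of_finiteDimensional _)
    rintro _ ⟨J, rfl⟩
    simpa only [adjoint_gnsRep] using! h J
  rw [cdim, Cardinal.toENat_le_natCast]
  exact (Submodule.rank_mono hle).trans (rank_span_finset_le S)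

theorem exists_smul_of_cdim_le_one (ω : CStarState (CuntzAlgebra n)) (h : ω.cdim ≤ 1)
    (J : List (CuntzIndex n)) : ∃ d : ℂ, ω.gnsRep (star (word J)) ω.gnsVector = d • ω.gnsVector := by
  rw [cdim, Cardinal.toENat_le_one, rank_submodule_le_one_iff'] at h
  obtain ⟨v, hv⟩ := h
  -- The empty word puts Ω itself, which is nonzero, into the line spanned by `v`.
  obtain ⟨a, ha⟩ := Submodule.mem_span_singleton.mp (hv (ω.gnsRep_star_word_mem_corrSpace []))
  obtain ⟨b, hb⟩ := Submodule.mem_span_singleton.mp (hv (ω.gnsRep_star_word_mem_corrSpace J))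
  have ha' : a • v = ω.gnsVector := by simpa using ha
  have ha0 : a ≠ 0 := by
    rintro rfl
    exact ω.gnsVector_ne_zero (by simpa using ha'.symm)
  exact ⟨b * a⁻¹, by rw [← hb, ← ha', smul_smul, inv_mul_cancel_right₀ ha0]⟩

theorem cdim_le_one_of_apply_s (ω : CStarState (CuntzAlgebra n)) {i : CuntzIndex n} {c : ℂ}
    (hc : ‖c‖ = 1) (h : ω (s i) = c) : ω.cdim ≤ 1 := by
  have := ω.cdim_le_card {ω.gnsVector} fun J => by
    rw [map_star_word_apply _ (ω.gnsRep_star_s_gnsVector hc h)]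
    exact Submodule.smul_mem _ _ (Submodule.subset_span (by simp))
  simpa using this

theorem kappa_le_cdim (ω φ : CStarState (CuntzAlgebra n)) (h : φ.Equivalent ω) :
    ω.kappa ≤ φ.cdim :=
  sInf_le ⟨φ, h, rfl⟩

/-- If the GNS vector is a joint eigenvector of the `π(s_j)⋆`, then it is not orthogonal to any
eigenvector of a generator. -/
theorem inner_gnsVector_ne_zero (φ : CStarState (CuntzAlgebra n)) {d : CuntzIndex n → ℂ}
    (hd : ∀ j, φ.gnsRep (star (s j)) φ.gnsVector = d j • φ.gnsVector) {ξ : φ.GNS} (hξ : ξ ≠ 0)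
    {i : CuntzIndex n} {c : ℂ} (hc : c ≠ 0) (h : φ.gnsRep (s i) ξ = c • ξ) :
    ⟪ξ, φ.gnsVector⟫_ℂ ≠ 0 := by
  intro h0
  let f : CuntzAlgebra n →ₗ[ℂ] ℂ :=
    { toFun := fun a => ⟪ξ, φ.gnsRep a φ.gnsVector⟫_ℂ
      map_add' := fun a b => by simp [inner_add_right]
      map_smul' := fun c a => by simp }
  have hf : Continuous f := by
    have : Continuous φ.gnsRep := map_continuous φ.gnsRep
    change Continuous fun a => ⟪ξ, φ.gnsRep a φ.gnsVector⟫_ℂ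
    fun_prop
  -- In ⟪ξ, s_I s_J⋆ Ω⟫, s_J⋆ acts on Ω by a scalar, and s_I, moved to the left side, acts as s_I⋆
  -- on ξ by a scalar. What remains is a multiple of ⟪ξ, Ω⟫ = 0. By cyclicity ξ is then orthogonal
  -- to the whole space.
  have h1 : f = 0 := by
    refine linearMap_ext hf continuous_zero fun I J => ?_
    change ⟪ξ, φ.gnsRep (word I * star (word J)) φ.gnsVector⟫_ℂ = 0
    rw [map_mul, mul_apply_eq_comp, map_star_word_apply _ hd, map_smul, inner_smul_right,
      ← ContinuousLinearMap.adjoint_inner_left, adjoint_gnsRep,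
      map_star_word_apply _ (map_star_s_apply _ hc h), inner_smul_left, h0, mul_zero, mul_zero]
  have h2 : ⟪ξ, ξ⟫_ℂ = 0 := by
    refine φ.denseRange_gnsRep_gnsVector.induction_on (p := fun y => ⟪ξ, y⟫_ℂ = 0) ξ
      (isClosed_eq (by fun_prop) continuous_const) fun a => ?_
    exact congrArg (fun g : CuntzAlgebra n →ₗ[ℂ] ℂ => g a) h1
  exact hξ (inner_self_eq_zero.mp h2)

/-- If `π(s_i)` has eigenvectors to two nonzero eigenvalues in the GNS representation of a state,
then `cdim` of this state is at least `2`. -/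
theorem one_lt_cdim_of_eigenvectors (φ : CStarState (CuntzAlgebra n)) {ξ ζ : φ.GNS} (hξ : ξ ≠ 0)
    (hζ : ζ ≠ 0) {i : CuntzIndex n} {b c : ℂ} (hb : b ≠ 0) (hc : c ≠ 0) (hbc : b ≠ c)
    (hb' : φ.gnsRep (s i) ξ = b • ξ) (hc' : φ.gnsRep (s i) ζ = c • ζ) : 1 < φ.cdim := by
  by_contra! hle
  have hex (j) : ∃ d : ℂ, φ.gnsRep (star (s j)) φ.gnsVector = d • φ.gnsVector := by
    simpa using φ.exists_smul_of_cdim_le_one hle [j]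
  choose d hd using hex
  -- Moving s_i across ⟪η, s_i⋆ Ω⟫ gives d_i⟪η, Ω⟫ = ā⟪η, Ω⟫, and the inner product is nonzero. Thus
  -- d_i fixes the eigenvalue, so two different ones cannot occur.
  have key : ∀ (η : φ.GNS) (a : ℂ), η ≠ 0 → a ≠ 0 → φ.gnsRep (s i) η = a • η →
      d i = star a := by
    intro η a hη ha h
    have h1 := φ.inner_gnsVector_ne_zero hd hη ha h
    have h2 : ⟪η, φ.gnsRep (star (s i)) φ.gnsVector⟫_ℂ = ⟪φ.gnsRep (s i) η, φ.gnsVector⟫_ℂ := by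
      rw [← adjoint_gnsRep, ContinuousLinearMap.adjoint_inner_right]
    rw [hd, h, inner_smul_left, inner_smul_right] at h2
    exact mul_right_cancel₀ h1 h2
  exact hbc (star_injective ((key ξ b hξ hb hb').symm.trans (key ζ c hζ hc hc')))

end CStarState

/-! ### The permutative representation on sequences of indices -/

theorem IsCuntzFamily.of_star_mul {n : ℕ∞} {B : Type*} [CStarAlgebra B] {t : CuntzIndex n → B}
    (h : ∀ i j, star (t i) * t j = if i = j then 1 else 0)
    (h1 : n ≠ ⊤ → ∑ᶠ i, t i * star (t i) = 1) : IsCuntzFamily t where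
  star_mul := h
  sum_eq_one := h1
  sum_le_one _ :=
    letI := CStarAlgebra.spectralOrder B
    haveI := CStarAlgebra.spectralOrderedRing B
    sum_mul_star_le_one h

/-- This rotation turns an eigenvalue 1 of the shift into a prescribed `c` of modulus 1. -/
theorem IsCuntzFamily.smul {n : ℕ∞} {B : Type*} [CStarAlgebra B] {t : CuntzIndex n → B}
    (h : IsCuntzFamily t) {c : ℂ} (hc : ‖c‖ = 1) : IsCuntzFamily fun i => c • t i := by
  have hc1 : star c * c = 1 := by
    rw [Complex.star_def, Complex.conj_mul', hc]; norm_num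
  refine .of_star_mul (fun i j => ?_) fun hn => ?_
  · rw [star_smul, smul_mul_smul_comm, hc1, one_smul, h.star_mul]
  · rw [← h.sum_eq_one hn]
    refine finsum_congr fun i => ?_
    rw [star_smul, smul_mul_smul_comm, mul_comm, hc1, one_smul]

namespace ShiftRepresentation

/-- The Hilbert space `ℓ²` over the set of sequences in `α`. -/
abbrev Space (α : Type) : Type := lp (fun _ : Stream' α => ℂ) 2

open scoped Classical in
/-- The basis vector at a sequence. -/
def basisVec {α : Type} (x : Stream' α) : Space α := lp.single 2 x 1

variable {α : Type}

theorem inner_basisVec_left (x : Stream' α) (f : Space α) : ⟪basisVec x, f⟫_ℂ = f x := by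
  classical
  rw [basisVec, lp.inner_single_left]
  simp

open scoped Classical in
theorem basisVec_apply (x y : Stream' α) : basisVec x y = if y = x then 1 else 0 := by
  simp [basisVec, lp.single_apply, Pi.single_apply]

theorem orthonormal_basisVec : Orthonormal ℂ (basisVec (α := α)) := by
  classical
  rw [orthonormal_iff_ite]
  intro x y
  rw [inner_basisVec_left, basisVec_apply]

theorem orthonormal_basisVec_cons (a : α) :
    Orthonormal ℂ fun x : Stream' α => basisVec (Stream'.cons a x) :=
  orthonormal_basisVec.comp _ (Stream'.cons_injective_right a)

/-- The isometry that prepends `a` to the sequences labelling the basis vectors. -/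
def shift (a : α) : Space α →L[ℂ] Space α :=
  (orthonormal_basisVec_cons a).orthogonalFamily.linearIsometry.toContinuousLinearMap

theorem shift_basisVec (a : α) (x : Stream' α) :
    shift a (basisVec x) = basisVec (Stream'.cons a x) := by
  classical
  refine ((orthonormal_basisVec_cons a).orthogonalFamily.linearIsometry_apply_single _).trans ?_
  simp

theorem clm_ext {S T : Space α →L[ℂ] Space α} (h : ∀ x, S (basisVec x) = T (basisVec x)) :
    S = T := by
  classical
  refine lp.ext_continuousLinearMap (by norm_num) fun x => ?_
  ext1
  simpa [basisVec] using h x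

open scoped Classical in
theorem adjoint_shift_basisVec (a : α) (x : Stream' α) :
    ContinuousLinearMap.adjoint (shift a) (basisVec x) =
      if x.head = a then basisVec x.tail else 0 := by
  ext y
  rw [← inner_basisVec_left, ContinuousLinearMap.adjoint_inner_right, shift_basisVec,
    inner_basisVec_left, basisVec_apply]
  by_cases h : x.head = a
  · have : Stream'.cons a y = x ↔ y = x.tail := by
      constructor
      · rintro rfl; rfl
      · rintro rfl; rw [← h, Stream'.eta]
    simp [h, this, basisVec_apply]
  · have : Stream'.cons a y ≠ x := by
      rintro rfl; exact h rfl
    simp [h, this]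

theorem isCuntzFamily_shift {n : ℕ∞} : IsCuntzFamily (shift (α := CuntzIndex n)) := by
  classical
  refine .of_star_mul (fun i j => clm_ext fun x => ?_) fun hn => ?_
  · rw [ContinuousLinearMap.star_eq_adjoint, mul_apply_eq_comp, shift_basisVec,
      adjoint_shift_basisVec, Stream'.head_cons, Stream'.tail_cons]
    by_cases h : i = j
    · simp [h]
    · simp [h, Ne.symm h]
  · have : Finite (CuntzIndex n) := by
      lift n to ℕ using hn
      exact Set.Finite.to_subtype ((Set.finite_lt_nat n).subset fun i hi => by
        simpa using (show ((i : ℕ) : ℕ∞) < (n : ℕ∞) from hi))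
    have := Fintype.ofFinite (CuntzIndex n)
    rw [finsum_eq_sum_of_fintype]
    refine clm_ext fun x => ?_
    -- The range projections sort the basis vectors by first letter, and each sequence has exactly
    -- one.
    have h (i : CuntzIndex n) : (shift i * star (shift i)) (basisVec x) =
        if x.head = i then basisVec x else 0 := by
      rw [ContinuousLinearMap.star_eq_adjoint, mul_apply_eq_comp, adjoint_shift_basisVec]
      split_ifs with hi
      · rw [shift_basisVec, ← hi, Stream'.eta]
      · simp
    simp [h]

end ShiftRepresentation

namespace CStarState

open CuntzAlgebra ShiftRepresentation

variable {n : ℕ∞}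

/-- For every generator and every scalar of modulus `1` there is a state which takes this value at
this generator. -/
theorem exists_apply_s_eq (i : CuntzIndex n) {c : ℂ} (hc : ‖c‖ = 1) :
    ∃ ω : CStarState (CuntzAlgebra n), ω (s i) = c := by
  obtain ⟨π, hπ⟩ := exists_lift _ (isCuntzFamily_shift.smul hc)
  have h1 : ‖basisVec (Stream'.const i)‖ = 1 := orthonormal_basisVec.1 _
  refine ⟨ofVector π _ h1, ?_⟩
  -- Prepending `i` fixes the constant sequence, so its basis vector is an eigenvector with
  -- eigenvalue `c`.
  rw [ofVector_apply, hπ, smul_apply, shift_basisVec, ← Stream'.const_eq,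
    inner_smul_right, inner_self_eq_norm_sq_to_K, h1]
  simp

/-! ### A nonminimal pure state -/

/-- The state `ω (s_j⋆ (·) s_j)`. -/
def conjGen (ω : CStarState (CuntzAlgebra n)) (j : CuntzIndex n) : CStarState (CuntzAlgebra n) :=
  ω.conj (s j) (by rw [star_s_mul_s_self, apply_one])

theorem conjGen_apply (ω : CStarState (CuntzAlgebra n)) (j : CuntzIndex n) (x : CuntzAlgebra n) :
    ω.conjGen j x = ω (star (s j) * x * s j) :=
  conj_apply _ _ _ _

/-- The conjugated state is the only state with value 1 at v = s_j s_i s_j⋆. If φ(v) = 1, then φ(s_j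
· s_j⋆) has value 1 at s_i and so equals `ω`; it remains to see that `φ` lives on the corner of p =
s_j s_j⋆. -/
theorem isPure_conjGen {ω : CStarState (CuntzAlgebra n)} {i : CuntzIndex n} (h : ω (s i) = 1)
    (j : CuntzIndex n) : (ω.conjGen j).IsPure := by
  have hvv : star (s j * s i * star (s j)) * (s j * s i * star (s j)) = s j * star (s j) := by
    calc _ = s j * (star (s i) * (star (s j) * s j) * s i) * star (s j) := by
          simp only [star_mul, star_star, mul_assoc]
      _ = _ := by rw [star_s_mul_s_self, mul_one, star_s_mul_s_self, mul_one]
  have hv : star (s j * s i * star (s j)) * (s j * s i * star (s j)) ≤ 1 :=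
    hvv.trans_le (s_mul_star_s_le_one j)
  refine isPure_of_forall_eq _ hv ?_ fun φ hφ => ?_
  · rw [conjGen_apply]
    have : star (s j) * (s j * s i * star (s j)) * s j =
        (star (s j) * s j) * s i * (star (s j) * s j) := by simp only [mul_assoc]
    rw [this, star_s_mul_s_self, one_mul, mul_one, h]
  · have hr := φ.apply_mul_right hv norm_one hφ
    have hl := φ.apply_star_mul_left hv norm_one hφ
    simp only [one_mul, star_one] at hr hl
    have hp : φ (star (star (s j)) * star (s j)) = 1 := by
      rw [star_star, ← hvv, hl, hφ]
    have hψ : φ.conj (star (s j)) hp = ω := by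
      refine eq_of_apply_s_eq (i := i) norm_one ?_ h
      rw [conj_apply, star_star, hφ]
    ext x
    rw [conjGen_apply, ← hψ, conj_apply, star_star]
    have hx : s j * (star (s j) * x * s j) * star (s j) =
        (s j * star (s j)) * x * (s j * star (s j)) := by simp only [mul_assoc]
    have hv2 : (s j * star (s j)) * (s j * s i * star (s j)) = s j * s i * star (s j) := by
      calc _ = s j * (star (s j) * s j) * s i * star (s j) := by simp only [mul_assoc]
        _ = _ := by rw [star_s_mul_s_self, mul_one]
    have hv3 : star (s j * s i * star (s j)) * (s j * star (s j)) =
        star (s j * s i * star (s j)) := by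
      have := congrArg star hv2
      rwa [star_mul, star_mul (s j), star_star] at this
    rw [hx]
    symm
    generalize s j * s i * star (s j) = v, s j * star (s j) = p at *
    -- Factors v⋆ on the left and `v` on the right do not change `φ`, and they absorb `p` because pv
    -- = v.
    calc φ (p * x * p) = φ (star v * (p * x * p * v)) := by rw [hl, hr]
      _ = φ (star v * p * (x * (p * v))) := by simp only [mul_assoc]
      _ = φ x := by rw [hv2, hv3, hl, hr]

/-- Equivalence with `ω` gives κ ≤ 1. If cdim were at most 1, then s_j⋆Ω' = dΩ' with d = ω(s_j⋆ s_j⋆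
s_j) = ω(s_j⋆) = 0, but ‖s_j⋆Ω'‖² = ω(1) = 1. -/
theorem not_isMinimal_conjGen {ω : CStarState (CuntzAlgebra n)} {i j : CuntzIndex n}
    (h : ω (s i) = 1) (hij : j ≠ i) : ¬ (ω.conjGen j).IsMinimal := by
  intro hmin
  have h1 : (ω.conjGen j).cdim ≤ 1 := by
    rw [hmin]
    exact (kappa_le_cdim _ ω (ω.equivalent_conj (s j) (star_s_mul_s_self j) _)).trans
      (ω.cdim_le_one_of_apply_s norm_one h)
  obtain ⟨d, hd⟩ := exists_smul_of_cdim_le_one _ h1 [j]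
  rw [word_cons, word_nil, mul_one] at hd
  have e1 := (ω.conjGen j).inner_gnsVector (star (s j))
  rw [conjGen_apply, hd, inner_smul_right, inner_self_eq_norm_sq_to_K, norm_gnsVector, mul_assoc,
    star_s_mul_s_self, mul_one, apply_star, ω.apply_s_of_ne norm_one h hij] at e1
  have hd0 : d = 0 := by simpa using e1
  have e2 := (ω.conjGen j).norm_gnsRep_gnsVector_sq (star (s j))
  have e3 : star (s j) * (star (star (s j)) * star (s j)) * s j = 1 := by
    calc _ = (star (s j) * s j) * (star (s j) * s j) := by rw [star_star]; simp only [mul_assoc]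
      _ = 1 := by rw [star_s_mul_s_self, mul_one]
  rw [hd, hd0, conjGen_apply, e3, apply_one] at e2
  simp at e2

/-! ### A mixed minimal state -/

theorem apply_s_mul_s (ω : CStarState (CuntzAlgebra n)) {i : CuntzIndex n} {c : ℂ}
    (hc : ‖c‖ = 1) (h : ω (s i) = c) : ω (s i * s i) = c * c := by
  rw [ω.apply_mul_right (star_s_mul_s_self_le_one i) hc h, h]

/-- The average has value 0 at s_i and 1 at s_i², so s_i² fixes Ω, and Ω ± s_iΩ are eigenvectors of
s_i for ±1. They bound cdim from above for the average, and from below for every equivalent state.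
-/
theorem isMinimal_average {ω φ : CStarState (CuntzAlgebra n)} {i : CuntzIndex n}
    (hω : ω (s i) = 1) (hφ : φ (s i) = -1) : (ω.average φ).IsMinimal := by
  set ψ := ω.average φ with hψ
  have h0 : ψ (s i) = 0 := by rw [hψ, average_apply, hω, hφ]; simp
  have h2 : ψ (s i * s i) = 1 := by
    rw [hψ, average_apply, ω.apply_s_mul_s norm_one hω, φ.apply_s_mul_s (by simp) hφ]
    norm_num
  have hss : star (s i * s i) * (s i * s i) ≤ 1 := by
    have : star (s i * s i) * (s i * s i) = star (s i) * (star (s i) * s i) * s i := by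
      simp only [star_mul, mul_assoc]
    rw [this, star_s_mul_s_self, mul_one, star_s_mul_s_self]
  have hsq : ψ.gnsRep (s i) (ψ.gnsRep (s i) ψ.gnsVector) = ψ.gnsVector := by
    have := ψ.gnsRep_gnsVector_eq_smul hss norm_one h2
    rwa [one_smul, map_mul, mul_apply_eq_comp] at this
  let ξ (c : ℂ) : ψ.GNS := ψ.gnsVector + c • ψ.gnsRep (s i) ψ.gnsVector
  have hξ (c : ℂ) (hc : c * c = 1) : ψ.gnsRep (s i) (ξ c) = c • ξ c := by
    simp only [ξ, map_add, map_smul, hsq, smul_add, smul_smul, hc, one_smul]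
    exact add_comm _ _
  have hξ0 (c : ℂ) : ξ c ≠ 0 := by
    intro h
    -- Since ψ(s_i) = 0, the pairing of Ω with ξ(c) is 1.
    have := congrArg (fun v => ⟪ψ.gnsVector, v⟫_ℂ) h
    simp only [ξ, inner_add_right, inner_smul_right, inner_gnsVector, h0, inner_zero_right,
      inner_self_eq_norm_sq_to_K, norm_gnsVector] at this
    simp at this
  have hp := hξ 1 (by norm_num)
  have hm := hξ (-1) (by norm_num)
  refine le_antisymm (le_sInf ?_) (kappa_le_cdim _ _ (Equivalent.refl _))
  rintro _ ⟨θ, hθ, rfl⟩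
  -- The unitary is needed in the direction that carries the eigenvectors of `ψ` into the GNS space
  -- of `θ`.
  obtain ⟨U, hU⟩ := hθ.symm
  have hlow : 1 < θ.cdim := θ.one_lt_cdim_of_eigenvectors (ξ := U (ξ 1)) (ζ := U (ξ (-1)))
    (i := i) (b := 1) (c := -1) (by simpa using hξ0 1) (by simpa using hξ0 (-1)) one_ne_zero
    (by norm_num) (by norm_num) (by rw [← hU, hp, map_smul]) (by rw [← hU, hm, map_smul])
  have hup : ψ.cdim ≤ 2 := by
    classical
    refine (ψ.cdim_le_card {ξ 1, ξ (-1)} fun J => ?_).trans (by exact_mod_cast Finset.card_le_two)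
    have hΩ : ψ.gnsVector = (1 / 2 : ℂ) • (ξ 1 + ξ (-1)) := by
      simp only [ξ]
      module
    have h1 : ξ 1 ∈ Submodule.span ℂ (({ξ 1, ξ (-1)} : Finset ψ.GNS) : Set ψ.GNS) :=
      Submodule.subset_span (by simp)
    have h2 : ξ (-1) ∈ Submodule.span ℂ (({ξ 1, ξ (-1)} : Finset ψ.GNS) : Set ψ.GNS) :=
      Submodule.subset_span (by simp)
    rw [hΩ, map_smul, map_add, map_star_word_apply _ (map_star_s_apply _ one_ne_zero hp),
      map_star_word_apply _ (map_star_s_apply _ (by norm_num) hm)]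
    exact Submodule.smul_mem _ _ (add_mem (Submodule.smul_mem _ _ h1) (Submodule.smul_mem _ _ h2))
  refine hup.trans ?_
  have := Order.add_one_le_of_lt hlow
  rwa [one_add_one_eq_two] at this

end CStarState

end

theorem proposition3p4 (n : ℕ∞) (hn : 2 ≤ n) :
    ∃ ωp ωm : CStarState (CuntzAlgebra n),
      -- `ωp` and `ωm` are the Cuntz states by `(1, 0, …, 0)` and by `(-1, 0, …, 0)`
      (∀ φ : CStarState (CuntzAlgebra n),
        φ.IsCuntzState (lp.single 2 (CuntzIndex.first hn) (1 : ℂ)) ↔ φ = ωp) ∧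
      (∀ φ : CStarState (CuntzAlgebra n),
        φ.IsCuntzState (lp.single 2 (CuntzIndex.first hn) (-1 : ℂ)) ↔ φ = ωm) ∧
      (∃ ω' : CStarState (CuntzAlgebra n),
        (∀ x, ω' x = ωp (star (CuntzAlgebra.s (CuntzIndex.second hn)) * x *
          CuntzAlgebra.s (CuntzIndex.second hn))) ∧
        ω'.IsPure ∧ ¬ ω'.IsMinimal) ∧
      (∃ ω'' : CStarState (CuntzAlgebra n),
        (∀ x, ω'' x = (ωp x + ωm x) / 2) ∧
        ω''.IsMinimal ∧ ¬ ω''.IsPure) := by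
  have hm1 : ‖(-1 : ℂ)‖ = 1 := by simp
  obtain ⟨ωp, hp⟩ := CStarState.exists_apply_s_eq (CuntzIndex.first hn) (norm_one (α := ℂ))
  obtain ⟨ωm, hm⟩ := CStarState.exists_apply_s_eq (CuntzIndex.first hn) hm1
  have hij : CuntzIndex.second hn ≠ CuntzIndex.first hn := by
    simp [CuntzIndex.second, CuntzIndex.first]
  refine ⟨ωp, ωm, fun φ => ?_, fun φ => ?_,
    ⟨ωp.conjGen _, ωp.conjGen_apply _, CStarState.isPure_conjGen hp _,
      CStarState.not_isMinimal_conjGen hp hij⟩,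
    ⟨ωp.average ωm, ωp.average_apply ωm, CStarState.isMinimal_average hp hm,
      CStarState.not_isPure_average ?_⟩⟩
  · rw [φ.isCuntzState_single_iff norm_one, star_one]
    exact ⟨fun h => CStarState.eq_of_apply_s_eq norm_one h hp, fun h => h ▸ hp⟩
  · rw [φ.isCuntzState_single_iff hm1, star_neg, star_one]
    exact ⟨fun h => CStarState.eq_of_apply_s_eq hm1 h hm, fun h => h ▸ hm⟩
  · rintro rfl
    rw [hp] at hm
    norm_num at hm
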